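/- Let $\Lambda$ be a finite set of edge labels and $\mathrm{ar}\colon\Lambda\to\mathbb{N}$ a function. A ($\Lambda$-)hypergraph $G$ consists of a finite set $V_G$ of nodes, a finite set $E_G$ of edges, a connection function $c_G\colon E_G\to V_G^*$ and a labelling $l_G\colon E_G\to\Lambda$ such that the word $c_G(e)$ has length $\mathrm{ar}(l_G(e))$ for every $e\in E_G$. A node $v$ and an edge $e$ are incident if $v$ occurs in $c_G(e)$. An undirected path of length $n$ in $G$ is an alternating sequence $v_0,e_1,v_1,\dots,e_n,v_n$ of pairwise distinct nodes and pairwise distinct edges such that $v_{i-1}$ and $v_i$ are incident to $e_i$ for all $1\le i\le n$. Two hypergraphs are isomorphic if there are bijections between their node sets and between their edge sets that respect $c$ and $l$. Write $G_1\subseteq G_2$, and call $G_1$ a subgraph of $G_2$, if $G_1$ is isomorphic to a hypergraph obtained from $G_2$ by a finite (possibly empty) sequence of deletions of edges and of isolated nodes (nodes not incident to any edge). Proposition. The relation $\subseteq$ is a quasi-order (reflexive and transitive) on $\Lambda$-hypergraphs, and for every $k\in\mathbb{N}$ it is a well-quasi-order on the set $\mathcal{G}_k$ of those $\Lambda$-hypergraphs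 in which every undirected path has length at most $k$: for every infinite sequence $G_0,G_1,G_2,\dots$ in $\mathcal{G}_k$ there are indices $i<j$ with $G_i\subseteq G_j$. -/

import Mathlib

universe u v w

/-- A `Λ`-hypergraph over the label alphabet `Λ` with arity function `ar`: finitely many nodes,
finitely many edges, and for each edge a label and an ordered list of nodes (repetitions allowed)
whose length is the arity of the label. Parallel edges and edges of arity zero are allowed. -/
structure LabelledHypergraph (Λ : Type w) (ar : Λ → ℕ) : Type (max (u + 1) (v + 1) w) where
  V : Type u
  E : Type v
  finite_V : Finite V
  finite_E : Finite E
  conn : E → List V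
  label : E → Λ
  length_conn : ∀ e : E, (conn e).length = ar (label e)

namespace LabelledHypergraph

variable {Λ : Type w} {ar : Λ → ℕ}

/-- The edge `e` and the node `v` are incident if `v` occurs in the node list of `e`. -/
def Incident (G : LabelledHypergraph.{u, v, w} Λ ar) (v : G.V) (e : G.E) : Prop :=
  v ∈ G.conn e

/-- An elementary undirected path `v₀, e₁, v₁, …, eₙ, vₙ` of length `n`: consecutive nodes are
incident to the edge between them, and no node and no edge is repeated. The edge `eᵢ₊₁` of the
sequence is `edge i`, for `i = 0, …, n - 1`. -/
structure UndirectedPath (G : LabelledHypergraph.{u, v, w} Λ ar) (n : ℕ) where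
  node : Fin (n + 1) → G.V
  edge : Fin n → G.E
  incident_left : ∀ i : Fin n, G.Incident (node i.castSucc) (edge i)
  incident_right : ∀ i : Fin n, G.Incident (node i.succ) (edge i)
  node_injective : Function.Injective node
  edge_injective : Function.Injective edge

/-- The hypergraphs all of whose undirected paths have length at most `k`. -/
def pathBounded (Λ : Type w) (ar : Λ → ℕ) (k : ℕ) : Set (LabelledHypergraph.{u, v, w} Λ ar) :=
  {G | ∀ n : ℕ, Nonempty (G.UndirectedPath n) → n ≤ k}

/-- An isomorphism: a total bijective morphism, i.e. a bijection on nodes and a bijection on edges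
which preserve the labels and the ordered node lists of the edges. -/
structure Iso (G H : LabelledHypergraph.{u, v, w} Λ ar) where
  onV : G.V ≃ H.V
  onE : G.E ≃ H.E
  label_onE : ∀ e : G.E, H.label (onE e) = G.label e
  conn_onE : ∀ e : G.E, H.conn (onE e) = (G.conn e).map onV

/-- Deletion of the edge `e`. -/
def deleteEdge (G : LabelledHypergraph.{u, v, w} Λ ar) (e : G.E) : LabelledHypergraph.{u, v, w} Λ ar where
  V := G.V
  E := {e' : G.E // e' ≠ e}
  finite_V := G.finite_V
  finite_E := haveI := G.finite_E; inferInstance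
  conn e' := G.conn e'.1
  label e' := G.label e'.1
  length_conn e' := G.length_conn e'.1

/-- A node is isolated if no edge is incident to it. -/
def IsIsolated (G : LabelledHypergraph.{u, v, w} Λ ar) (v : G.V) : Prop :=
  ∀ e : G.E, ¬ G.Incident v e

/-- Deletion of the isolated node `v`. -/
def deleteNode (G : LabelledHypergraph.{u, v, w} Λ ar) (v : G.V) (hv : G.IsIsolated v) :
    LabelledHypergraph.{u, v, w} Λ ar where
  V := {w : G.V // w ≠ v}
  E := G.E
  finite_V := haveI := G.finite_V; inferInstance
  finite_E := G.finite_E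
  conn e := (G.conn e).attachWith (fun w => w ≠ v) (fun _ hw hwv => hv e (hwv ▸ hw))
  label := G.label
  length_conn e := by rw [List.length_attachWith]; exact G.length_conn e

/-- `DeletionStep G H`: `H` arises from `G` by deleting one edge or one isolated node. -/
inductive DeletionStep : LabelledHypergraph.{u, v, w} Λ ar → LabelledHypergraph.{u, v, w} Λ ar → Prop
  | edge (G : LabelledHypergraph.{u, v, w} Λ ar) (e : G.E) : DeletionStep G (G.deleteEdge e)
  | node (G : LabelledHypergraph.{u, v, w} Λ ar) (v : G.V) (hv : G.IsIsolated v) :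
      DeletionStep G (G.deleteNode v hv)

/-- The subgraph ordering: `G₁` is, up to isomorphism, obtained from `G₂` by a finite (possibly
empty) sequence of deletions of edges and isolated nodes. -/
def IsSubgraph (G₁ G₂ : LabelledHypergraph.{u, v, w} Λ ar) : Prop :=
  ∃ H : LabelledHypergraph.{u, v, w} Λ ar,
    Relation.ReflTransGen DeletionStep G₂ H ∧ Nonempty (Iso G₁ H)

end LabelledHypergraph

/-! The proof follows Ding's argument for graphs of bounded path length: bounded paths give bounded
tree-depth, and Higman's lemma is applied once per level of the depth. Being a subgraph is the same
as admitting an injective morphism, so it suffices to find embeddings.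

Let `a` bound the arities. In a connected part, grow a path, each time removing all nodes of the
part incident to the next edge, at most `a` of them. Every remaining component still hangs on the
end of some longer path, so after at most `k` rounds nothing remains. Hence each hypergraph
decomposes by disjoint unions and node removals nested at most `k * a + 1` deep (`decomp_univ`).

Removed nodes are kept as roots that embeddings must respect. A piece of depth `n` is a disjoint
sum, over its roots, of atoms: single edges on roots, or pieces that become of depth `n - 1` when
one more node is made a root. Edges are handled by pigeonhole, the other atoms by induction, and
lists of atoms by Higman's lemma; embeddings of summands glue because they agree on the roots
(`Emb.of_isSum`). -/

namespace LabelledHypergraph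
variable {Λ : Type w} {ar : Λ → ℕ}

/-! ### Subgraphs as embeddings -/

/-- An embedding: an injective morphism of labelled hypergraphs. -/
structure Embedding (G H : LabelledHypergraph.{u, v, w} Λ ar) where
  onV : G.V → H.V
  onE : G.E → H.E
  onV_injective : Function.Injective onV
  onE_injective : Function.Injective onE
  label_onE : ∀ e : G.E, H.label (onE e) = G.label e
  conn_onE : ∀ e : G.E, H.conn (onE e) = (G.conn e).map onV

/-- The identity embedding. -/
def Embedding.refl (G : LabelledHypergraph.{u, v, w} Λ ar) : Embedding G G :=
  ⟨id, id, Function.injective_id, Function.injective_id, fun _ => rfl, fun _ => by simp⟩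

/-- Composition of embeddings. -/
def Embedding.trans {G H K : LabelledHypergraph.{u, v, w} Λ ar} (f : Embedding G H)
    (g : Embedding H K) : Embedding G K :=
  ⟨g.onV ∘ f.onV, g.onE ∘ f.onE, g.onV_injective.comp f.onV_injective,
    g.onE_injective.comp f.onE_injective, fun e => by simp [g.label_onE, f.label_onE],
    fun e => by simp [g.conn_onE, f.conn_onE]⟩

/-- An isomorphism is an embedding. -/
def Iso.toEmbedding {G H : LabelledHypergraph.{u, v, w} Λ ar} (f : Iso G H) : Embedding G H :=
  ⟨f.onV, f.onE, f.onV.injective, f.onE.injective, f.label_onE, f.conn_onE⟩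

theorem DeletionStep.embedding {G H : LabelledHypergraph.{u, v, w} Λ ar} (h : DeletionStep G H) :
    Nonempty (Embedding H G) := by
  cases h with
  | edge e =>
    exact ⟨⟨id, Subtype.val, Function.injective_id, Subtype.val_injective, fun _ => rfl,
      fun _ => by simp [deleteEdge]⟩⟩
  | node v hv =>
    exact ⟨⟨Subtype.val, id, Subtype.val_injective, Function.injective_id, fun _ => rfl,
      fun e => by simp [deleteNode]; rfl⟩⟩

theorem IsSubgraph.embedding {G H : LabelledHypergraph.{u, v, w} Λ ar} (h : IsSubgraph G H) :
    Nonempty (Embedding G H) := by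
  obtain ⟨K, hK, ⟨i⟩⟩ := h
  suffices Nonempty (Embedding K H) from this.map i.toEmbedding.trans
  clear i
  induction hK with
  | refl => exact ⟨.refl _⟩
  | tail _ hs ih =>
    obtain ⟨f⟩ := hs.embedding
    exact ih.map f.trans

/-- Delete what the embedding misses, edges before nodes, by induction on the size of `H`. -/
theorem Embedding.isSubgraph {G H : LabelledHypergraph.{u, v, w} Λ ar} (f : Embedding G H) :
    IsSubgraph G H := by
  obtain ⟨n, hn⟩ : ∃ n, Nat.card H.V + Nat.card H.E = n := ⟨_, rfl⟩
  induction n using Nat.strong_induction_on generalizing H with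
  | _ n ih =>
  have := H.finite_V
  have := H.finite_E
  suffices h : (∃ K, DeletionStep H K ∧ Nat.card K.V + Nat.card K.E < n ∧
      Nonempty (Embedding G K)) ∨ Nonempty (Iso G H) by
    obtain ⟨K, hs, hlt, ⟨g⟩⟩ | hi := h
    · obtain ⟨K', hK', hi⟩ := ih _ hlt g rfl
      exact ⟨K', .head hs hK', hi⟩
    · exact ⟨H, .refl, hi⟩
  by_cases hE : Function.Surjective f.onE
  · by_cases hV : Function.Surjective f.onV
    · exact .inr ⟨⟨.ofBijective _ ⟨f.onV_injective, hV⟩, .ofBijective _ ⟨f.onE_injective, hE⟩,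
        f.label_onE, f.conn_onE⟩⟩
    · left
      simp only [Function.Surjective, not_forall, not_exists] at hV
      obtain ⟨x, hx⟩ := hV
      -- Every edge is now an image, so all its nodes are images, and a missed node lies on no edge.
      have hiso : H.IsIsolated x := by
        intro e he
        obtain ⟨e, rfl⟩ := hE e
        rw [Incident, f.conn_onE, List.mem_map] at he
        obtain ⟨y, -, hy⟩ := he
        exact hx y hy
      refine ⟨_, .node H x hiso, ?_, ⟨⟨fun y => ⟨f.onV y, hx y⟩, f.onE, ?_, f.onE_injective,
        f.label_onE, fun e => ?_⟩⟩⟩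
      · rw [← hn]
        exact Nat.add_lt_add_right (Finite.card_subtype_lt (x := x) (by simp)) _
      · exact fun y z h => f.onV_injective (Subtype.ext_iff.1 h)
      · apply List.map_injective_iff.2 Subtype.val_injective
        simp [deleteNode, f.conn_onE]
  · left
    simp only [Function.Surjective, not_forall, not_exists] at hE
    obtain ⟨x, hx⟩ := hE
    refine ⟨_, .edge H x, ?_, ⟨⟨f.onV, fun e => ⟨f.onE e, hx e⟩, f.onV_injective, ?_,
      f.label_onE, f.conn_onE⟩⟩⟩
    · rw [← hn]
      exact Nat.add_lt_add_left (Finite.card_subtype_lt (x := x) (by simp)) _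
    · exact fun y z h => f.onE_injective (Subtype.ext_iff.1 h)

theorem isSubgraph_isPreorder :
    IsPreorder (LabelledHypergraph.{u, v, w} Λ ar) IsSubgraph where
  refl G := (Embedding.refl G).isSubgraph
  trans _ _ _ h h' := by
    obtain ⟨f⟩ := h.embedding
    obtain ⟨g⟩ := h'.embedding
    exact (f.trans g).isSubgraph

/-! ### Bounded paths give decompositions of bounded depth -/

theorem exists_arity_bound [Finite Λ] (ar : Λ → ℕ) : ∃ a, ∀ l, ar l ≤ a := by
  obtain ⟨a, ha⟩ := (Set.finite_range ar).bddAbove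
  exact ⟨a, fun l => ha ⟨l, rfl⟩⟩

/-- The edges incident to a node of `U`. -/
def star (G : LabelledHypergraph.{u, v, w} Λ ar) (U : Set G.V) : Set G.E :=
  {e | ∃ x ∈ U, G.Incident x e}

/-- `G.Decomp n S U F`: once the nodes of `S` are removed, the nodes `U` and the edges `F` can be
decomposed by passing to disjoint parts and removing nodes, with at most `n` nested removals. -/
inductive Decomp (G : LabelledHypergraph.{u, v, w} Λ ar) :
    ℕ → Set G.V → Set G.V → Set G.E → Prop
  | empty (n : ℕ) (S : Set G.V) : Decomp G n S ∅ ∅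
  | edge (n : ℕ) (S : Set G.V) (e : G.E) (he : ∀ x ∈ G.conn e, x ∈ S) : Decomp G n S ∅ {e}
  | node (n : ℕ) (S U : Set G.V) (F : Set G.E) (x : G.V) (hS : x ∉ S) (hU : x ∉ U)
      (h : Decomp G n (insert x S) U F) : Decomp G (n + 1) S (insert x U) F
  | union (n : ℕ) (S U U' : Set G.V) (F F' : Set G.E) (hU : Disjoint U U') (hF : Disjoint F F')
      (h : Decomp G n S U F) (h' : Decomp G n S U' F') : Decomp G n S (U ∪ U') (F ∪ F')

section Decomp

variable {G : LabelledHypergraph.{u, v, w} Λ ar}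

theorem Decomp.mono {n m : ℕ} {S U : Set G.V} {F : Set G.E} (h : G.Decomp n S U F)
    (hnm : n ≤ m) : G.Decomp m S U F := by
  induction h generalizing m with
  | empty => exact .empty _ _
  | edge n S e he => exact .edge _ _ e he
  | node n S U F x hS hU h ih =>
    obtain ⟨m, rfl⟩ : ∃ k, m = k + 1 := ⟨m - 1, by omega⟩
    exact .node _ _ _ _ _ hS hU (ih (by omega))
  | union n S U U' F F' hU hF h h' ih ih' => exact .union _ _ _ _ _ _ hU hF (ih hnm) (ih' hnm)

theorem Decomp.closed {n : ℕ} {S U : Set G.V} {F : Set G.E} (h : G.Decomp n S U F) :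
    ∀ e ∈ F, ∀ x ∈ G.conn e, x ∈ S ∪ U := by
  induction h with
  | empty => simp
  | edge n S e he => simpa using he
  | node n S U F x hS hU h ih =>
    intro e he y hy
    have := ih e he y hy
    simp only [Set.mem_union, Set.mem_insert_iff] at this ⊢
    tauto
  | union n S U U' F F' hU hF h h' ih ih' =>
    rintro e (he | he) y hy
    · exact (ih e he y hy).imp_right .inl
    · exact (ih' e he y hy).imp_right .inr

theorem Decomp.edges {n : ℕ} {S : Set G.V} (F : Set G.E)
    (hF : ∀ e ∈ F, ∀ x ∈ G.conn e, x ∈ S) : G.Decomp n S ∅ F := by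
  have := G.finite_E
  induction F, F.toFinite using Set.Finite.induction_on with
  | empty => exact .empty _ _
  | @insert e F he _ ih =>
    have := Decomp.union n S ∅ ∅ {e} F (by simp) (by simpa using he)
      (.edge _ _ e (hF e (Set.mem_insert e F)))
      (ih fun e' he' => hF e' (Set.mem_insert_of_mem e he'))
    rwa [Set.union_empty, ← Set.insert_eq] at this

theorem Decomp.nodes {n : ℕ} {S T U : Set G.V} {F : Set G.E} (hTS : Disjoint T S)
    (hTU : Disjoint T U) (h : G.Decomp n (S ∪ T) U F) : G.Decomp (n + T.ncard) S (T ∪ U) F := by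
  have := G.finite_V
  induction T, T.toFinite using Set.Finite.induction_on generalizing S with
  | empty => simpa using h
  | @insert x T hx _ ih =>
    rw [Set.ncard_insert_of_notMem hx, ← add_assoc, Set.insert_union]
    rw [Set.disjoint_insert_left] at hTS hTU
    refine .node _ _ _ _ _ hTS.1 (by simp [hx, hTU.1]) (ih ?_ hTU.2 ?_)
    · simp [hx, hTS.2]
    · rwa [Set.insert_union, ← Set.union_insert]

/-- `P` is a union of connected components of the sub-hypergraph induced by `U`. -/
def IsPart (G : LabelledHypergraph.{u, v, w} Λ ar) (U P : Set G.V) : Prop :=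
  P ⊆ U ∧ Disjoint (G.star P) (G.star (U \ P))

theorem star_mono {U U' : Set G.V} (h : U ⊆ U') : G.star U ⊆ G.star U' :=
  fun _ ⟨x, hx, he⟩ => ⟨x, h hx, he⟩

theorem star_union (U U' : Set G.V) : G.star (U ∪ U') = G.star U ∪ G.star U' := by
  ext e
  simp only [star, Set.mem_ofPred_eq, Set.mem_union]
  constructor
  · rintro ⟨x, h | h, he⟩
    exacts [.inl ⟨x, h, he⟩, .inr ⟨x, h, he⟩]
  · rintro (⟨x, h, he⟩ | ⟨x, h, he⟩)
    exacts [⟨x, .inl h, he⟩, ⟨x, .inr h, he⟩]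

theorem IsPart.diff {U P : Set G.V} (h : G.IsPart U P) : G.IsPart U (U \ P) := by
  refine ⟨Set.sdiff_subset, ?_⟩
  rw [Set.sdiff_sdiff_cancel_left h.1]
  exact h.2.symm

theorem IsPart.trans {U P Q : Set G.V} (h : G.IsPart U P) (h' : G.IsPart P Q) :
    G.IsPart U Q := by
  refine ⟨h'.1.trans h.1, ?_⟩
  have : U \ Q = (P \ Q) ∪ (U \ P) := by
    ext x
    have := @h.1 x
    have := @h'.1 x
    simp only [Set.mem_sdiff, Set.mem_union]
    tauto
  rw [this, star_union, Set.disjoint_union_right]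
  exact ⟨h'.2, h.2.mono_left (star_mono h'.1)⟩

/-- `U` is nonempty and connected. -/
def IsConn (G : LabelledHypergraph.{u, v, w} Λ ar) (U : Set G.V) : Prop :=
  U.Nonempty ∧ ∀ P, P.Nonempty → G.IsPart U P → P = U

/-- Split along a proper part and induct on the number of nodes: a part and its complement have
disjoint stars, so the edges split as well. -/
theorem Decomp.of_components {n : ℕ} {S U : Set G.V}
    (H : ∀ P, G.IsPart U P → G.IsConn P → G.Decomp n S P (G.star P)) :
    G.Decomp n S U (G.star U) := by
  have := G.finite_V
  obtain ⟨m, hm⟩ : ∃ m, U.ncard = m := ⟨_, rfl⟩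
  induction m using Nat.strong_induction_on generalizing U with
  | _ m ih =>
  obtain rfl | hne := U.eq_empty_or_nonempty
  · have : G.star ∅ = ∅ := by simp [star]
    rw [this]
    exact .empty _ _
  by_cases hc : G.IsConn U
  · exact H U ⟨subset_rfl, by simp [star]⟩ hc
  simp only [IsConn, hne, true_and, not_forall] at hc
  obtain ⟨P, hP, hpart, hPU⟩ := hc
  have key : ∀ Q, G.IsPart U Q → Q ≠ U → G.Decomp n S Q (G.star Q) := fun Q hQ hQU =>
    ih _ (hm ▸ Set.ncard_lt_ncard (hQ.1.ssubset_of_ne hQU)) (fun R hR => H R (hQ.trans hR)) rfl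
  have := Decomp.union n S P (U \ P) _ _ Set.disjoint_sdiff_right hpart.2
    (key P hpart hPU) (key _ hpart.diff (by
      obtain ⟨x, hx⟩ := hP
      exact fun h => (h.symm ▸ hpart.1 hx : x ∈ U \ P).2 hx))
  rwa [← star_union, Set.union_sdiff_cancel hpart.1] at this

/-- Removing the nodes of `T` from `U` and decomposing the rest. -/
theorem Decomp.remove {n a : ℕ} {S T U : Set G.V} (hSU : Disjoint S U)
    (hcl : ∀ e ∈ G.star U, ∀ x ∈ G.conn e, x ∈ S ∪ U) (hTU : T ⊆ U) (ha : T.ncard ≤ a)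
    (h : G.Decomp n (S ∪ T) (U \ T) (G.star (U \ T))) :
    G.Decomp (n + a) S U (G.star U) := by
  have hsub : G.star (U \ T) ⊆ G.star U := star_mono Set.sdiff_subset
  -- The edges lost by removing `T` have all their nodes in `S ∪ T`, so they are leaves of the
  -- decomposition.
  have h1 := Decomp.union n (S ∪ T) _ ∅ _ (G.star U \ G.star (U \ T)) (by simp)
    Set.disjoint_sdiff_right h (.edges _ ?_)
  · rw [Set.union_sdiff_cancel hsub, Set.union_empty] at h1
    have := (h1.nodes (hSU.symm.mono_left hTU) Set.disjoint_sdiff_right).mono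
      (Nat.add_le_add_left ha n)
    rwa [Set.union_sdiff_cancel hTU] at this
  · rintro e ⟨he, he'⟩ x hx
    by_contra hc
    have hxU := hcl e he x hx
    simp only [Set.mem_union, not_or] at hc hxU
    exact he' ⟨x, ⟨hxU.resolve_left hc.1, hc.2⟩, hx⟩

/-- Extension of a path by an edge and a node. -/
def UndirectedPath.extend {n : ℕ} (p : G.UndirectedPath n) (e : G.E) (x : G.V)
    (hl : G.Incident (p.node (Fin.last n)) e) (hr : G.Incident x e)
    (hx : ∀ i, p.node i ≠ x) (he : ∀ i, p.edge i ≠ e) : G.UndirectedPath (n + 1) where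
  node := Fin.snoc (α := fun _ => G.V) p.node x
  edge := Fin.snoc (α := fun _ => G.E) p.edge e
  incident_left i := by
    induction i using Fin.lastCases with
    | last => simpa using hl
    | cast i => simpa using p.incident_left i
  incident_right i := by
    induction i using Fin.lastCases with
    | last => simpa using hr
    | cast i =>
      rw [Fin.succ_castSucc, Fin.snoc_castSucc, Fin.snoc_castSucc]
      exact p.incident_right i
  node_injective := Fin.snoc_injective_iff.2 ⟨p.node_injective, by simpa using hx⟩
  edge_injective := Fin.snoc_injective_iff.2 ⟨p.edge_injective, by simpa using he⟩

/-- Every union of components of `U` has an edge to the end of a path of length `n` which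
avoids it. -/
def Attached (G : LabelledHypergraph.{u, v, w} Λ ar) (n : ℕ) (U : Set G.V) : Prop :=
  ∀ P, P.Nonempty → G.IsPart U P → ∃ p : G.UndirectedPath n, (∀ i, p.node i ∉ P) ∧
    (∀ i, p.edge i ∉ G.star P) ∧ ∃ e ∈ G.star P, G.Incident (p.node (Fin.last n)) e

/-- Otherwise no edge at `P` would meet `T`, so `P` would be a part of the connected set `U` itself,
hence all of `U`. -/
theorem IsConn.exists_edge {U T P : Set G.V} (hU : G.IsConn U) (hTU : T ⊆ U) (hT : T.Nonempty)
    (hP : P.Nonempty) (hpart : G.IsPart (U \ T) P) :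
    ∃ e ∈ G.star P, ∃ x ∈ T, G.Incident x e := by
  by_contra! hc
  have hsub : P ⊆ U := hpart.1.trans Set.sdiff_subset
  have hPU : P = U := by
    refine hU.2 P hP ⟨hsub, ?_⟩
    have : U \ P ⊆ T ∪ ((U \ T) \ P) := by
      rintro x ⟨hx, hxP⟩
      by_cases hxT : x ∈ T
      exacts [.inl hxT, .inr ⟨⟨hx, hxT⟩, hxP⟩]
    refine Disjoint.mono_right (star_mono this) ?_
    rw [star_union, Set.disjoint_union_right]
    refine ⟨Set.disjoint_left.2 ?_, hpart.2⟩
    rintro e he ⟨x, hx, hxe⟩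
    exact hc e he x hx hxe
  obtain ⟨x, hx⟩ := hT
  exact (hpart.1 (hPU ▸ hTU hx)).2 hx

theorem IsPart.closed {S U P : Set G.V} (hcl : ∀ e ∈ G.star U, ∀ x ∈ G.conn e, x ∈ S ∪ U)
    (hP : G.IsPart U P) : ∀ e ∈ G.star P, ∀ x ∈ G.conn e, x ∈ S ∪ P := by
  intro e he x hx
  refine (hcl e (star_mono hP.1 he) x hx).imp_right fun hxU => ?_
  by_contra hxP
  exact Set.disjoint_left.1 hP.2 he ⟨x, ⟨hxU, hxP⟩, hx⟩

theorem closed_remove {S U T : Set G.V} (hcl : ∀ e ∈ G.star U, ∀ x ∈ G.conn e, x ∈ S ∪ U) :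
    ∀ e ∈ G.star (U \ T), ∀ x ∈ G.conn e, x ∈ (S ∪ T) ∪ (U \ T) := by
  intro e he x hx
  have := hcl e (star_mono Set.sdiff_subset he) x hx
  simp only [Set.mem_union, Set.mem_sdiff] at this ⊢
  tauto

theorem disjoint_remove {S U T : Set G.V} (hSU : Disjoint S U) :
    Disjoint (S ∪ T) (U \ T) :=
  Set.disjoint_union_left.2 ⟨hSU.mono_right Set.sdiff_subset, Set.disjoint_sdiff_right⟩

theorem ncard_incident_le {a : ℕ} (ha : ∀ l, ar l ≤ a) (e : G.E) (U : Set G.V) :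
    {x | x ∈ U ∧ G.Incident x e}.ncard ≤ a := by
  classical
  refine le_trans ?_ (((G.conn e).toFinset_card_le.trans_eq (G.length_conn e)).trans (ha _))
  rw [← Set.ncard_coe_finset]
  exact Set.ncard_le_ncard (fun x hx => List.mem_toFinset.2 hx.2) (Finset.finite_toSet _)

/-- Each of the `m` remaining rounds costs at most `a` removals and lengthens the attached paths by
one. -/
theorem decomp_of_attached {k a : ℕ} (ha : ∀ l, ar l ≤ a) (hG : G ∈ pathBounded Λ ar k)
    (m n : ℕ) (hmn : n + m = k) (S U : Set G.V) (hSU : Disjoint S U)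
    (hcl : ∀ e ∈ G.star U, ∀ x ∈ G.conn e, x ∈ S ∪ U) (hat : G.Attached n U) :
    G.Decomp (m * a) S U (G.star U) := by
  induction m generalizing n S U with
  | zero =>
    refine .of_components fun P hP hconn => ?_
    obtain ⟨p, hpn, hpe, e, ⟨x, hx, hxe⟩, he⟩ := hat P hconn.1 hP
    -- At `n = k` the extended path has length `k + 1`, so no component exists.
    have := hG _ ⟨p.extend e x he hxe (fun i h => hpn i (h ▸ hx))
      fun i h => hpe i ⟨x, hx, h ▸ hxe⟩⟩
    omega
  | succ m ih =>
    refine .of_components fun P hP hconn => ?_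
    obtain ⟨p, hpn, hpe, e, ⟨x, hx, hxe⟩, he⟩ := hat P hconn.1 hP
    rw [Nat.succ_mul]
    have hSP := hSU.mono_right hP.1
    have hclP := hP.closed hcl
    -- All nodes of `e` in `P` are removed, not just one, so that `e` is not incident to what
    -- remains and cannot be reused by a longer path.
    have hTP : {x | x ∈ P ∧ G.Incident x e} ⊆ P := fun x hx => hx.1
    refine .remove hSP hclP hTP (ncard_incident_le ha e P)
      (ih (n + 1) (by omega) _ _ (disjoint_remove hSP) (closed_remove hclP) ?_)
    intro Q hQ hQpart
    have hQP := hQpart.1.trans Set.sdiff_subset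
    obtain ⟨f, hf, y, ⟨hy, hye⟩, hyf⟩ := hconn.exists_edge hTP ⟨x, hx, hxe⟩ hQ hQpart
    refine ⟨p.extend e y he hye (fun i h => hpn i (h ▸ hy))
      fun i h => hpe i ⟨y, hy, h ▸ hye⟩, fun i => ?_, fun i => ?_, f, hf, ?_⟩
    · induction i using Fin.lastCases with
      | last =>
        simp only [UndirectedPath.extend, Fin.snoc_last]
        exact fun h => (hQpart.1 h).2 ⟨hy, hye⟩
      | cast i =>
        simp only [UndirectedPath.extend, Fin.snoc_castSucc]
        exact fun h => hpn i (hQP h)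
    · induction i using Fin.lastCases with
      | last =>
        simp only [UndirectedPath.extend, Fin.snoc_last]
        rintro ⟨z, hz, hze⟩
        exact (hQpart.1 hz).2 ⟨hQP hz, hze⟩
      | cast i =>
        simp only [UndirectedPath.extend, Fin.snoc_castSucc]
        exact fun h => hpe i (star_mono hQP h)
    · simpa [UndirectedPath.extend] using hyf

/-- The extra `1` pays for a starting node in each component, which serves as a path of length zero.
-/
theorem decomp_univ {k a : ℕ} (ha : ∀ l, ar l ≤ a) (hG : G ∈ pathBounded Λ ar k) :
    G.Decomp (k * a + 1) ∅ Set.univ Set.univ := by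
  have h : G.Decomp (k * a + 1) ∅ Set.univ (G.star Set.univ) := by
    refine .of_components fun P hP hconn => ?_
    obtain ⟨x, hx⟩ := hconn.1
    have hcl : ∀ e ∈ G.star P, ∀ x ∈ G.conn e, x ∈ ∅ ∪ P := hP.closed (by simp)
    have hxP : {x} ⊆ P := by simpa using hx
    refine .remove (Set.empty_disjoint _) hcl hxP (by simp)
      (decomp_of_attached ha hG k 0 (by omega) _ _ (disjoint_remove (Set.empty_disjoint _))
        (closed_remove hcl) ?_)
    intro Q hQ hQpart
    obtain ⟨f, hf, y, rfl, hyf⟩ := hconn.exists_edge hxP ⟨x, rfl⟩ hQ hQpart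
    exact ⟨⟨fun _ => y, Fin.elim0, fun i => i.elim0, fun i => i.elim0,
      fun i j _ => Subsingleton.elim (α := Fin 1) i j, fun i => i.elim0⟩,
      fun _ h => (hQpart.1 h).2 rfl, fun i => i.elim0, f, hf, hyf⟩
  -- The edges outside the star of all nodes are those of arity zero.
  have h' := Decomp.union _ ∅ _ ∅ _ (G.star Set.univ)ᶜ (by simp) disjoint_compl_right h
    (.edges _ fun e he x hx => (he ⟨x, trivial, hx⟩).elim)
  rwa [Set.union_compl_self, Set.union_empty] at h'

end Decomp

/-! ### Rooted pieces and their embeddings -/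

/-- A part of a hypergraph, given by nodes `U` and edges `F`, over the removed nodes `root r`. -/
structure Piece (Λ : Type w) (ar : Λ → ℕ) (R : Type) : Type (max (u + 1) (v + 1) w) where
  G : LabelledHypergraph.{u, v, w} Λ ar
  root : R → G.V
  root_injective : Function.Injective root
  U : Set G.V
  F : Set G.E
  closed : ∀ e ∈ F, ∀ x ∈ G.conn e, x ∈ Set.range root ∪ U

/-- `α` is the graph of an injective map from `A` to `B`. -/
structure PartialInj {X : Type*} {Y : Type*} (α : X → Y → Prop) (A : Set X) (B : Set Y) :
    Prop where
  dom : ∀ x y, α x y → x ∈ A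
  ran : ∀ x y, α x y → y ∈ B
  total : ∀ x ∈ A, ∃ y, α x y
  inj : ∀ x x' y, α x y → α x' y → x = x'
  func : ∀ x y y', α x y → α x y' → y = y'

theorem PartialInj.refl {X : Type*} (A : Set X) : PartialInj (fun x y => x = y ∧ x ∈ A) A A where
  dom _ _ h := h.2
  ran _ _ h := h.1 ▸ h.2
  total x hx := ⟨x, rfl, hx⟩
  inj _ _ _ h h' := h.1.trans h'.1.symm
  func _ _ _ h h' := h.1.symm.trans h'.1

theorem PartialInj.comp {X Y Z : Type*} {α : X → Y → Prop} {β : Y → Z → Prop} {A : Set X}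
    {B : Set Y} {C : Set Z} (h : PartialInj α A B) (h' : PartialInj β B C) :
    PartialInj (Relation.Comp α β) A C where
  dom _ _ := fun ⟨_, h1, _⟩ => h.dom _ _ h1
  ran _ _ := fun ⟨_, _, h2⟩ => h'.ran _ _ h2
  total x hx := by
    obtain ⟨y, hy⟩ := h.total x hx
    obtain ⟨z, hz⟩ := h'.total y (h.ran _ _ hy)
    exact ⟨z, y, hy, hz⟩
  inj x x' z := by
    rintro ⟨y, h1, h2⟩ ⟨y', h3, h4⟩
    obtain rfl := h'.inj _ _ _ h2 h4
    exact h.inj _ _ _ h1 h3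
  func x z z' := by
    rintro ⟨y, h1, h2⟩ ⟨y', h3, h4⟩
    obtain rfl := h.func _ _ _ h1 h3
    exact h'.func _ _ _ h2 h4

theorem PartialInj.mono {X Y : Type*} {α : X → Y → Prop} {A : Set X} {B B' : Set Y}
    (h : PartialInj α A B) (hB : B ⊆ B') : PartialInj α A B' :=
  { h with ran := fun x y hxy => hB (h.ran x y hxy) }

theorem PartialInj.union {X Y : Type*} {α β : X → Y → Prop} {A A' : Set X} {B B' : Set Y}
    (h : PartialInj α A B) (h' : PartialInj β A' B')
    (hfun : ∀ x y y', α x y → β x y' → y = y') (hinj : ∀ x x' y, α x y → β x' y → x = x') :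
    PartialInj (fun x y => α x y ∨ β x y) (A ∪ A') (B ∪ B') where
  dom _ _ := Or.imp (h.dom _ _) (h'.dom _ _)
  ran _ _ := Or.imp (h.ran _ _) (h'.ran _ _)
  total x := by
    rintro (hx | hx)
    · exact (h.total x hx).imp fun _ => .inl
    · exact (h'.total x hx).imp fun _ => .inr
  inj x x' y := by
    rintro (h1 | h1) (h2 | h2)
    exacts [h.inj _ _ _ h1 h2, hinj _ _ _ h1 h2, (hinj _ _ _ h2 h1).symm, h'.inj _ _ _ h1 h2]
  func x y y' := by
    rintro (h1 | h1) (h2 | h2)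
    exacts [h.func _ _ _ h1 h2, hfun _ _ _ h1 h2, (hfun _ _ _ h2 h1).symm, h'.func _ _ _ h1 h2]

namespace Piece

variable {R : Type}

/-- Embeddings of pieces, which respect the removed nodes. -/
def Emb (X Y : Piece.{u, v, w} Λ ar R) : Prop :=
  ∃ (α : X.G.V → Y.G.V → Prop) (β : X.G.E → Y.G.E → Prop),
    PartialInj α (Set.range X.root ∪ X.U) (Set.range Y.root ∪ Y.U) ∧
    PartialInj β X.F Y.F ∧ (∀ r, α (X.root r) (Y.root r)) ∧
    (∀ x y, α x y → x ∈ X.U → y ∈ Y.U) ∧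
    ∀ e e', β e e' → X.G.label e = Y.G.label e' ∧ List.Forall₂ α (X.G.conn e) (Y.G.conn e')

theorem Emb.refl (X : Piece.{u, v, w} Λ ar R) : Emb X X := by
  refine ⟨_, _, .refl _, .refl _, fun r => ⟨rfl, .inl ⟨r, rfl⟩⟩, fun x y h hx => h.1 ▸ hx, ?_⟩
  rintro e _ ⟨rfl, he⟩
  exact ⟨rfl, List.forall₂_same.2 fun x hx => ⟨rfl, X.closed e he x hx⟩⟩

theorem forall₂_comp {X Y Z : Type*} {α : X → Y → Prop} {β : Y → Z → Prop} {k : List X}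
    {l : List Y} {m : List Z} (h : List.Forall₂ α k l) (h' : List.Forall₂ β l m) :
    List.Forall₂ (Relation.Comp α β) k m := by
  induction h generalizing m with
  | nil => cases h'; exact .nil
  | cons h1 _ ih =>
    cases h' with
    | cons h2 h3 => exact .cons ⟨_, h1, h2⟩ (ih h3)

theorem Emb.trans {X Y Z : Piece.{u, v, w} Λ ar R} (h : Emb X Y) (h' : Emb Y Z) : Emb X Z := by
  obtain ⟨α, β, hα, hβ, hr, hU, hc⟩ := h
  obtain ⟨α', β', hα', hβ', hr', hU', hc'⟩ := h'
  refine ⟨_, _, hα.comp hα', hβ.comp hβ', fun r => ⟨_, hr r, hr' r⟩, ?_, ?_⟩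
  · rintro x z ⟨y, h1, h2⟩ hx
    exact hU' _ _ h2 (hU _ _ h1 hx)
  · rintro e e'' ⟨e', h1, h2⟩
    exact ⟨(hc _ _ h1).1.trans (hc' _ _ h2).1, forall₂_comp (hc _ _ h1).2 (hc' _ _ h2).2⟩

instance : IsPreorder (Piece.{u, v, w} Λ ar R) Emb where
  refl := Emb.refl
  trans _ _ _ := Emb.trans

/-- The relation between corresponding removed nodes is the graph of an injective map. -/
theorem partialInj_root {A B : Type*} {f : R → A} {g : R → B} (hf : Function.Injective f)
    (hg : Function.Injective g) :
    PartialInj (fun x y => ∃ r, x = f r ∧ y = g r) (Set.range f) (Set.range g) where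
  dom := by rintro _ _ ⟨r, rfl, rfl⟩; exact ⟨r, rfl⟩
  ran := by rintro _ _ ⟨r, rfl, rfl⟩; exact ⟨r, rfl⟩
  total := by rintro _ ⟨r, rfl⟩; exact ⟨_, r, rfl, rfl⟩
  inj := by
    rintro _ _ _ ⟨r, rfl, rfl⟩ ⟨s, rfl, h⟩
    rw [hg h]
  func := by
    rintro _ _ _ ⟨r, rfl, rfl⟩ ⟨s, h, rfl⟩
    rw [hf h]

theorem partialInj_single {A B : Type*} (a : A) (b : B) :
    PartialInj (fun x y => x = a ∧ y = b) {a} {b} where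
  dom _ _ h := h.1
  ran _ _ h := h.2
  total _ hx := ⟨b, hx, rfl⟩
  inj _ _ _ h h' := h.1.trans h'.1.symm
  func _ _ _ h h' := h.2.trans h'.2.symm

/-! ### Disjoint sums of pieces -/

/-- The sub-piece with nodes `U` and edges `F` of a hypergraph with given removed nodes is the
disjoint union of the pieces in a list. -/
inductive IsSum (G : LabelledHypergraph.{u, v, w} Λ ar) (root : R → G.V)
    (hroot : Function.Injective root) :
    List (Piece.{u, v, w} Λ ar R) → Set G.V → Set G.E → Prop
  | nil : IsSum G root hroot [] ∅ ∅
  | cons (l : List (Piece.{u, v, w} Λ ar R)) (U U' : Set G.V) (F F' : Set G.E)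
      (h : ∀ e ∈ F, ∀ x ∈ G.conn e, x ∈ Set.range root ∪ U)
      (hU : Disjoint U U') (hF : Disjoint F F') (hl : IsSum G root hroot l U' F') :
      IsSum G root hroot (⟨G, root, hroot, U, F, h⟩ :: l) (U ∪ U') (F ∪ F')

section IsSum

variable {G : LabelledHypergraph.{u, v, w} Λ ar} {root : R → G.V}
  {hroot : Function.Injective root}

theorem IsSum.closed {l : List (Piece.{u, v, w} Λ ar R)} {U : Set G.V} {F : Set G.E}
    (h : IsSum G root hroot l U F) : ∀ e ∈ F, ∀ x ∈ G.conn e, x ∈ Set.range root ∪ U := by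
  induction h with
  | nil => simp
  | cons l U U' F F' h hU hF hl ih =>
    rintro e (he | he) x hx
    · exact (h e he x hx).imp_right .inl
    · exact (ih e he x hx).imp_right .inr

theorem IsSum.append {l l' : List (Piece.{u, v, w} Λ ar R)} {U U' : Set G.V} {F F' : Set G.E}
    (h : IsSum G root hroot l U F) (h' : IsSum G root hroot l' U' F') (hU : Disjoint U U')
    (hF : Disjoint F F') : IsSum G root hroot (l ++ l') (U ∪ U') (F ∪ F') := by
  induction h with
  | nil => simpa using h'
  | cons l U1 U2 F1 F2 h hU' hF' hl ih =>
    rw [Set.disjoint_union_left] at hU hF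
    rw [Set.union_assoc, Set.union_assoc]
    exact .cons _ _ _ _ _ h (Set.disjoint_union_right.2 ⟨hU', hU.1⟩)
      (Set.disjoint_union_right.2 ⟨hF', hF.1⟩) (ih hU.2 hF.2)

theorem IsSum.singleton {U : Set G.V} {F : Set G.E}
    (h : ∀ e ∈ F, ∀ x ∈ G.conn e, x ∈ Set.range root ∪ U) :
    IsSum G root hroot [⟨G, root, hroot, U, F, h⟩] U F := by
  simpa using IsSum.cons (hroot := hroot) [] U ∅ F ∅ h (by simp) (by simp) .nil

end IsSum

theorem Emb.of_empty (X Y : Piece.{u, v, w} Λ ar R) (hU : X.U = ∅) (hF : X.F = ∅) : Emb X Y := by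
  refine ⟨fun x y => ∃ r, x = X.root r ∧ y = Y.root r, fun _ _ => False, ?_, ?_, fun r => ⟨r, rfl, rfl⟩, by simp [hU], by simp⟩
  · rw [hU, Set.union_empty]
    exact (partialInj_root X.root_injective Y.root_injective).mono Set.subset_union_left
  · rw [hF]
    constructor <;> simp

theorem Emb.mono {X : Piece.{u, v, w} Λ ar R} {G : LabelledHypergraph.{u, v, w} Λ ar}
    {root : R → G.V} {hroot : Function.Injective root} {U U' : Set G.V} {F F' : Set G.E} {hc hc'}
    (h : Emb X ⟨G, root, hroot, U, F, hc⟩) (hU : U ⊆ U') (hF : F ⊆ F') :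
    Emb X ⟨G, root, hroot, U', F', hc'⟩ := by
  obtain ⟨α, β, hα, hβ, hr, hαU, hβc⟩ := h
  exact ⟨α, β, hα.mono (Set.union_subset_union_right _ hU), hβ.mono hF, hr,
    fun x y h hx => hU (hαU x y h hx), hβc⟩

/-- The two embeddings overlap only on the roots, where both are prescribed, so their union is again
functional and injective. -/
theorem Emb.union {G G' : LabelledHypergraph.{u, v, w} Λ ar}
    {root : R → G.V} {hroot : Function.Injective root}
    {root' : R → G'.V} {hroot' : Function.Injective root'}
    {U₁ U₂ : Set G.V} {F₁ F₂ : Set G.E} {U₁' U₂' : Set G'.V} {F₁' F₂' : Set G'.E}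
    {h₁ h₂ h h₁' h₂' h'}
    (hU : Disjoint U₁ U₂) (hF : Disjoint F₁ F₂) (hU' : Disjoint U₁' U₂') (hF' : Disjoint F₁' F₂')
    (e₁ : Emb ⟨G, root, hroot, U₁, F₁, h₁⟩ ⟨G', root', hroot', U₁', F₁', h₁'⟩)
    (e₂ : Emb ⟨G, root, hroot, U₂, F₂, h₂⟩ ⟨G', root', hroot', U₂', F₂', h₂'⟩) :
    Emb ⟨G, root, hroot, U₁ ∪ U₂, F₁ ∪ F₂, h⟩
      ⟨G', root', hroot', U₁' ∪ U₂', F₁' ∪ F₂', h'⟩ := by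
  obtain ⟨α, β, hα, hβ, hr, hαU, hβc⟩ := e₁
  obtain ⟨α', β', hα', hβ', hr', hαU', hβc'⟩ := e₂
  dsimp only at *
  have hα2 := hα.union hα' ?_ ?_
  · rw [← Set.union_union_distrib_left, ← Set.union_union_distrib_left] at hα2
    refine ⟨_, _, hα2, hβ.union hβ' ?_ ?_, fun r => .inl (hr r), ?_, ?_⟩
    · exact fun x y y' h1 h2 =>
        (Set.disjoint_left.1 hF (hβ.dom _ _ h1) (hβ'.dom _ _ h2)).elim
    · exact fun x x' y h1 h2 =>
        (Set.disjoint_left.1 hF' (hβ.ran _ _ h1) (hβ'.ran _ _ h2)).elim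
    · dsimp only
      have root_eq : ∀ x y, (α x y ∨ α' x y) → x ∈ Set.range root → y ∈ Set.range root' := by
        rintro _ y hy ⟨r, rfl⟩
        exact ⟨r, hα2.func _ _ _ (.inl (hr r)) hy⟩
      rintro x y (hxy | hxy) (hx | hx)
      · exact .inl (hαU _ _ hxy hx)
      -- A piece does not require its roots to lie outside `U`, so `x` may be a root as well; both
      -- relations then send it to the same node.
      · obtain ⟨r, rfl⟩ | h := hα.dom _ _ hxy
        · obtain ⟨z, hz⟩ := hα'.total _ (.inr hx)
          obtain rfl := hα2.func _ _ _ (.inl hxy) (.inr hz)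
          exact .inr (hαU' _ _ hz hx)
        · exact .inl (hαU _ _ hxy h)
      · obtain ⟨z, hz⟩ := hα.total _ (.inr hx)
        obtain rfl := hα2.func _ _ _ (.inr hxy) (.inl hz)
        exact .inl (hαU _ _ hz hx)
      · exact .inr (hαU' _ _ hxy hx)
    · rintro e e' (h1 | h1)
      · exact ⟨(hβc _ _ h1).1, (hβc _ _ h1).2.imp fun _ _ => .inl⟩
      · exact ⟨(hβc' _ _ h1).1, (hβc' _ _ h1).2.imp fun _ _ => .inr⟩
  · intro x y y' h1 h2
    obtain ⟨r, rfl⟩ | hx := hα.dom _ _ h1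
    · rw [hα.func _ _ _ h1 (hr r), hα'.func _ _ _ h2 (hr' r)]
    obtain ⟨r, rfl⟩ | hx' := hα'.dom _ _ h2
    · rw [hα.func _ _ _ h1 (hr r), hα'.func _ _ _ h2 (hr' r)]
    exact (Set.disjoint_left.1 hU hx hx').elim
  · intro x x' y h1 h2
    obtain ⟨r, rfl⟩ | hx := hα.ran _ _ h1
    · rw [hα.inj _ _ _ h1 (hr r), hα'.inj _ _ _ h2 (hr' r)]
    obtain ⟨r, rfl⟩ | hx' := hα'.ran _ _ h2
    · rw [hα.inj _ _ _ h1 (hr r), hα'.inj _ _ _ h2 (hr' r)]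
    exact (Set.disjoint_left.1 hU' hx hx').elim

theorem Emb.of_isSum {G G' : LabelledHypergraph.{u, v, w} Λ ar}
    {root : R → G.V} {hroot : Function.Injective root}
    {root' : R → G'.V} {hroot' : Function.Injective root'}
    {l l' : List (Piece.{u, v, w} Λ ar R)} (hl : List.SublistForall₂ Emb l l')
    {U : Set G.V} {F : Set G.E} {U' : Set G'.V} {F' : Set G'.E}
    (h : IsSum G root hroot l U F) (h' : IsSum G' root' hroot' l' U' F') :
    Emb ⟨G, root, hroot, U, F, h.closed⟩ ⟨G', root', hroot', U', F', h'.closed⟩ := by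
  induction hl generalizing U F U' F' with
  | nil => cases h; exact .of_empty _ _ rfl rfl
  | cons hab _ ih =>
    cases h with
    | cons _ _ _ _ _ hc hU hF hs =>
      cases h' with
      | cons _ _ _ _ _ hc' hU' hF' hs' => exact .union hU hF hU' hF' hab (ih hs hs')
  | cons_right _ ih =>
    cases h' with
    | cons _ _ _ _ _ hc' hU' hF' hs' =>
      exact (ih h hs').mono Set.subset_union_right Set.subset_union_right

/-! ### Well-quasi-ordering by induction on depth -/

/-- Pieces consisting of one edge. -/
def edgePieces (Λ : Type w) (ar : Λ → ℕ) (R : Type) : Set (Piece.{u, v, w} Λ ar R) :=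
  {X | X.U = ∅ ∧ ∃ e, X.F = {e} ∧ ∀ x ∈ X.G.conn e, x ∈ Set.range X.root}

theorem Emb.of_edge {X Y : Piece.{u, v, w} Λ ar R} {e : X.G.E} {e' : Y.G.E} {l : List R}
    (hU : X.U = ∅) (hX : X.F = {e}) (hY : Y.F = {e'}) (hlabel : X.G.label e = Y.G.label e')
    (he : X.G.conn e = l.map X.root) (he' : Y.G.conn e' = l.map Y.root) : Emb X Y := by
  refine ⟨fun x y => ∃ r, x = X.root r ∧ y = Y.root r, fun x y => x = e ∧ y = e', ?_, ?_,
    fun r => ⟨r, rfl, rfl⟩, by simp [hU], ?_⟩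
  · rw [hU, Set.union_empty]
    exact (partialInj_root X.root_injective Y.root_injective).mono Set.subset_union_left
  · rw [hX, hY]
    exact partialInj_single e e'
  · rintro _ _ ⟨rfl, rfl⟩
    refine ⟨hlabel, ?_⟩
    rw [he, he', List.forall₂_map_left_iff, List.forall₂_map_right_iff]
    exact List.forall₂_same.2 fun r _ => ⟨r, rfl, rfl⟩

/-- Pigeonhole: an edge on the roots is determined by its label and a word over `R` of length at
most `a`, leaving finitely many types. -/
theorem partiallyWellOrderedOn_edgePieces [Finite Λ] [Finite R] {a : ℕ} (ha : ∀ l, ar l ≤ a) :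
    (edgePieces.{u, v, w} Λ ar R).PartiallyWellOrderedOn Emb := by
  rw [Set.partiallyWellOrderedOn_iff_exists_lt]
  intro f hf
  choose hU e hF hr using hf
  have hl : ∀ n, ∃ l : List R, l.map (f n).root = (f n).G.conn (e n) := fun n =>
    Set.mem_range.1 (by rw [Set.range_list_map]; exact hr n)
  choose l hl using hl
  have hla : ∀ n, (l n).length ≤ a := fun n => by
    rw [← List.length_map (f n).root, hl, (f n).G.length_conn]
    exact ha _
  have : Finite {l : List R // l.length ≤ a} := (List.finite_length_le R a).to_subtype
  obtain ⟨i, j, hij, h⟩ := Finite.exists_ne_map_eq_of_infinite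
    fun n => ((f n).G.label (e n), (⟨l n, hla n⟩ : {l : List R // l.length ≤ a}))
  simp only [Prod.mk.injEq, Subtype.mk.injEq] at h
  have key : ∀ i j, (f i).G.label (e i) = (f j).G.label (e j) → l i = l j → Emb (f i) (f j) :=
    fun i j h1 h2 => .of_edge (hU i) (hF i) (hF j) h1 (hl i).symm (h2 ▸ (hl j).symm)
  obtain hij | hij := lt_or_gt_of_ne hij
  · exact ⟨i, j, hij, key i j h.1 h.2⟩
  · exact ⟨j, i, hij, key j i h.1.symm h.2.symm⟩

/-- Pieces with a decomposition of depth `n`. -/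
def decompPieces (Λ : Type w) (ar : Λ → ℕ) (R : Type) (n : ℕ) : Set (Piece.{u, v, w} Λ ar R) :=
  {X | X.G.Decomp n (Set.range X.root) X.U X.F}

theorem range_option {A : Type*} (f : Option R → A) :
    Set.range f = insert (f none) (Set.range fun r => f (some r)) := by
  ext y
  simp [Option.exists, eq_comm]

/-- Putting back the removed node `root none`. -/
def restore (Y : Piece.{u, v, w} Λ ar (Option R)) : Piece.{u, v, w} Λ ar R where
  G := Y.G
  root r := Y.root (some r)
  root_injective := Y.root_injective.comp (Option.some_injective R)
  U := insert (Y.root none) Y.U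
  F := Y.F
  closed e he x hx := by
    obtain ⟨_ | r, rfl⟩ | h := Y.closed e he x hx
    · exact .inr (.inl rfl)
    · exact .inl ⟨r, rfl⟩
    · exact .inr (.inr h)

theorem restore_range_union (Y : Piece.{u, v, w} Λ ar (Option R)) :
    Set.range Y.restore.root ∪ Y.restore.U = Set.range Y.root ∪ Y.U := by
  rw [range_option Y.root, Set.insert_union]
  exact Set.union_insert

theorem Emb.restore {X Y : Piece.{u, v, w} Λ ar (Option R)} (h : Emb X Y) :
    Emb X.restore Y.restore := by
  obtain ⟨α, β, hα, hβ, hr, hU, hc⟩ := h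
  refine ⟨α, β, ?_, hβ, fun r => hr (some r), ?_, hc⟩
  · rwa [restore_range_union, restore_range_union]
  · rintro x y hxy (rfl | hx)
    · exact .inl (hα.func _ _ _ hxy (hr none))
    · exact .inr (hU x y hxy hx)

/-- Pieces which are indecomposable summands of a decomposition of depth `n`: single edges, and
pieces from which a node can be removed to leave a decomposition of smaller depth. -/
def atoms (Λ : Type w) (ar : Λ → ℕ) (R : Type) (n : ℕ) : Set (Piece.{u, v, w} Λ ar R) :=
  edgePieces Λ ar R ∪ {X | ∃ m, n = m + 1 ∧ X ∈ restore '' decompPieces Λ ar (Option R) m}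

/-- Nested unions flatten into one list; a node removal is a single atom whose removed node becomes
the root `none`. -/
theorem exists_isSum_atoms {G : LabelledHypergraph.{u, v, w} Λ ar} {n : ℕ} {S U : Set G.V}
    {F : Set G.E} (h : G.Decomp n S U F) (root : R → G.V) (hroot : Function.Injective root)
    (hS : Set.range root = S) :
    ∃ l : List (Piece.{u, v, w} Λ ar R), (∀ X ∈ l, X ∈ atoms Λ ar R n) ∧
      IsSum G root hroot l U F := by
  induction h with
  | empty => exact ⟨[], by simp, .nil⟩
  | edge n S e he =>
    subst hS
    have hc : ∀ e' ∈ ({e} : Set G.E), ∀ x ∈ G.conn e', x ∈ Set.range root ∪ ∅ := by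
      rintro _ rfl x hx
      exact .inl (he x hx)
    refine ⟨_, ?_, .singleton hc⟩
    rintro X hX
    obtain rfl := List.mem_singleton.1 hX
    exact .inl ⟨rfl, e, rfl, he⟩
  | node n S U F x hxS hxU h ih =>
    clear ih
    subst hS
    have hrange : Set.range (fun o : Option R => o.elim x root) = insert x (Set.range root) :=
      range_option _
    have hinj : Function.Injective (fun o : Option R => o.elim x root) := by
      rintro (_ | r) (_ | s) hrs
      · rfl
      · exact (hxS ⟨s, hrs.symm⟩).elim
      · exact (hxS ⟨r, hrs⟩).elim
      · exact congrArg some (hroot hrs)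
    have hc : ∀ e ∈ F, ∀ y ∈ G.conn e, y ∈ Set.range root ∪ insert x U :=
      (Decomp.node _ _ _ _ _ hxS hxU h).closed
    refine ⟨_, ?_, .singleton hc⟩
    intro X hX
    obtain rfl := List.mem_singleton.1 hX
    exact .inr ⟨n, rfl, ⟨G, fun o => o.elim x root, hinj, U, F, hrange ▸ h.closed⟩,
      (by simpa only [decompPieces, Set.mem_ofPred_eq, hrange] using h), rfl⟩
  | union n S U U' F F' hU hF h h' ih ih' =>
    obtain ⟨l, hl, hs⟩ := ih hS
    obtain ⟨l', hl', hs'⟩ := ih' hS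
    refine ⟨l ++ l', fun X hX => ?_, hs.append hs' hU hF⟩
    exact (List.mem_append.1 hX).elim (hl X) (hl' X)

/-- The root type must vary in the induction, since each level down replaces `R` by `Option R`. -/
theorem partiallyWellOrderedOn_decompPieces [Finite Λ] [Finite R] (n : ℕ) :
    (decompPieces.{u, v, w} Λ ar R n).PartiallyWellOrderedOn Emb := by
  obtain ⟨a, ha⟩ := exists_arity_bound ar
  induction n using Nat.strong_induction_on generalizing R with
  | _ n ih =>
  have hatoms : (atoms.{u, v, w} Λ ar R n).PartiallyWellOrderedOn Emb := by
    refine (partiallyWellOrderedOn_edgePieces ha).union ?_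
    obtain _ | m := n
    · simp
    · refine Set.PartiallyWellOrderedOn.mono ((ih m (by omega) (R := Option R)).image_of_monotone_on
        (f := restore) (r' := Emb) fun _ _ _ _ h => h.restore) ?_
      rintro X ⟨m', hm, hX⟩
      obtain rfl : m = m' := by omega
      exact hX
  -- Higman's lemma for lists of atoms.
  have hlists := Set.PartiallyWellOrderedOn.partiallyWellOrderedOn_sublistForall₂ _ hatoms
  rw [Set.partiallyWellOrderedOn_iff_exists_lt]
  intro f hf
  choose l hl hs using fun i => exists_isSum_atoms (hf i) (f i).root (f i).root_injective rfl
  obtain ⟨i, j, hij, h⟩ := hlists.exists_lt hl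
  exact ⟨i, j, hij, Emb.of_isSum h (hs i) (hs j)⟩

/-- A hypergraph as a piece without removed nodes. -/
def ofHypergraph (G : LabelledHypergraph.{u, v, w} Λ ar) : Piece.{u, v, w} Λ ar Empty :=
  ⟨G, Empty.elim, fun i => i.elim, Set.univ, Set.univ, by simp⟩

theorem eq_map_of_forall₂ {A B : Type*} {f : A → B} {k : List A} {l : List B}
    (h : List.Forall₂ (fun x y => y = f x) k l) : l = k.map f := by
  induction h with
  | nil => rfl
  | cons h _ ih => rw [h, ih, List.map_cons]

theorem Emb.embedding {G H : LabelledHypergraph.{u, v, w} Λ ar}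
    (h : Emb (ofHypergraph G) (ofHypergraph H)) : Nonempty (Embedding G H) := by
  obtain ⟨α, β, hα, hβ, -, -, hc⟩ := h
  choose f hf using fun x => hα.total x (.inr trivial)
  choose g hg using fun e => hβ.total e trivial
  refine ⟨⟨f, g, fun x y h => hα.inj _ _ _ (hf x) (h ▸ hf y),
    fun x y h => hβ.inj _ _ _ (hg x) (h ▸ hg y), fun e => (hc _ _ (hg e)).1.symm, fun e => ?_⟩⟩
  exact eq_map_of_forall₂ ((hc _ _ (hg e)).2.imp fun x y hxy => hα.func _ _ _ hxy (hf x))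

end Piece

end LabelledHypergraph

theorem mainTheorem8 {Λ : Type w} [Finite Λ] (ar : Λ → ℕ) :
    IsPreorder (LabelledHypergraph.{u, v, w} Λ ar) LabelledHypergraph.IsSubgraph ∧
      ∀ k : ℕ, (LabelledHypergraph.pathBounded.{u, v, w} Λ ar k).PartiallyWellOrderedOn
        LabelledHypergraph.IsSubgraph := by
  refine ⟨LabelledHypergraph.isSubgraph_isPreorder, fun k => ?_⟩
  obtain ⟨a, ha⟩ := LabelledHypergraph.exists_arity_bound ar
  rw [Set.partiallyWellOrderedOn_iff_exists_lt]
  intro f hf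
  have hmem : ∀ n, LabelledHypergraph.Piece.ofHypergraph (f n) ∈
      LabelledHypergraph.Piece.decompPieces.{u, v, w} Λ ar Empty (k * a + 1) := fun n => by
    simpa [LabelledHypergraph.Piece.decompPieces, LabelledHypergraph.Piece.ofHypergraph,
      Set.range_eq_empty] using
      LabelledHypergraph.decomp_univ ha (hf n)
  obtain ⟨i, j, hij, h⟩ :=
    (LabelledHypergraph.Piece.partiallyWellOrderedOn_decompPieces _).exists_lt hmem
  obtain ⟨g⟩ := h.embedding
  exact ⟨i, j, hij, g.isSubgraph⟩
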